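/- Let $K$ be a field, let $a,b\ge 0$ be integers and $\ell=a+b$. Let $x_0,\dots,x_k\in K$ be distinct, let $a_0,\dots,a_k\ge 0$ be integers with $a_0+\dots+a_k=\ell+1$, and let $y_{i,j}\in K$ for $0\le i\le k$, $0\le j<a_i$. The osculatory rational interpolation problem asks for polynomials $A,B\in K[x]$ with $B\neq 0$, $\deg A\le a$, $\deg B\le b$ such that, for all $0\le i\le k$ and $0\le j<a_i$, the rational function $A/B$ (in lowest terms) is defined at $x_i$ and the coefficient of $(x-x_i)^j$ in its Taylor expansion at $x_i$ is $y_{i,j}$ (in characteristic $0$ this says $(A/B)^{(j)}(x_i)=j!\,y_{i,j}$). Put $f=\prod_{i=0}^k(x-x_i)^{a_i}=\sum_{i=0}^{\ell+1}f_ix^i$, and let $g=\sum_{i=0}^{\ell}g_ix^i$ be the Hermite interpolation polynomial of the data, i.e. the unique polynomial of degree at most $\ell$ whose coefficient of $(x-x_i)^j$ in the expansion at $x_i$ is $y_{i,j}$ for all $0\le i\le k$, $0\le j<a_i$. For $0\le d\le\ell$ and $u,v\in K[x]$ let $D_d(u,v)$ be the determinant of the square matrix of size $2(\ell-d)+1$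 whose rows correspond, in this order, to $x^{\ell-d-1}f,\dots,x^0f,\,x^{\ell-d}g,\dots,x^0g$, whose first $2(\ell-d)$ columns contain the coefficients of these polynomials at $x^{2\ell-d},x^{2\ell-d-1},\dots,x^{d+1}$, and whose last column is $(x^{\ell-d-1}u,\dots,x^0u,\,x^{\ell-d}v,\dots,x^0v)^{T}$. Let $\operatorname{Sres}_d(f,g)=D_d(f,g)$ be the $d$-th subresultant and let $F_d=D_d(1,0)$, $G_d=D_d(0,1)$ be its Bézout cofactors, so that $\operatorname{Sres}_d(f,g)=F_df+G_dg$. Let $0\le d\le a$ be the maximal index with $\operatorname{Sres}_d(f,g)\neq 0$ (assuming that there is such an index). Then $\deg G_d\le b$, and the osculatory rational interpolation problem has a solution if and only if $G_d(x_i)\neq 0$ for every $0\le i\le k$ with $a_i>0$. In that case $A=\operatorname{Sres}_d(f,g)$, $B=G_d$ is a solution, every solution $(A,B)$ satisfies $$\frac{A}{B}=\frac{\operatorname{Sres}_d(f,g)}{G_d}$$ in $K(x)$, and $\gcd\big(\operatorname{Sres}_d(f,g),G_d\big)=1$. -/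

import Mathlib

open Polynomial

namespace OscInterp

noncomputable section

variable {K : Type*} [Field K]

/-! ### Taylor coefficients of rational functions -/

/-- `r` is defined at `c`: the denominator of its reduced form does not vanish there. -/
def IsRegularAt (r : RatFunc K) (c : K) : Prop :=
  r.denom.eval c ≠ 0

/-- The expansion at `c` of a rational function that is regular at `c`, as a power series in
`X - c`: the quotient of the Taylor polynomials of its numerator and denominator. -/
def expansion (r : RatFunc K) (c : K) : PowerSeries K :=
  (taylor c r.num : PowerSeries K) * (taylor c r.denom : PowerSeries K)⁻¹

/-- The `j`-th Taylor coefficient of `r` at `c`, that is, the `j`-th derivative divided by `j!`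
(the Hasse derivative, which makes sense in every characteristic). -/
def taylorCoeff (r : RatFunc K) (c : K) (j : ℕ) : K :=
  PowerSeries.coeff j (expansion r c)

/-- The formal derivative of a rational function. -/
def ratDeriv (r : RatFunc K) : RatFunc K :=
  (algebraMap K[X] (RatFunc K) (derivative r.num * r.denom - r.num * derivative r.denom)) /
    algebraMap K[X] (RatFunc K) (r.denom ^ 2)

theorem isRegularAt_div (p q : K[X]) (c : K) (hq : q.eval c ≠ 0) :
    IsRegularAt (algebraMap K[X] (RatFunc K) p / algebraMap K[X] (RatFunc K) q) c := by
  intro h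
  obtain ⟨s, hs⟩ := RatFunc.denom_div_dvd p q
  apply hq
  rw [hs, eval_mul, h, zero_mul]

theorem constCoeff_taylor (p : K[X]) (c : K) :
    PowerSeries.constantCoeff (taylor c p : PowerSeries K) = p.eval c := by
  rw [← PowerSeries.coeff_zero_eq_constantCoeff_apply, Polynomial.coeff_coe, taylor_coeff_zero]

theorem expansion_div (p q : K[X]) (c : K) (hq : q.eval c ≠ 0) :
    expansion (algebraMap K[X] (RatFunc K) p / algebraMap K[X] (RatFunc K) q) c =
      (taylor c p : PowerSeries K) * (taylor c q : PowerSeries K)⁻¹ := by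
  have hq0 : q ≠ 0 := by rintro rfl; simp at hq
  have hreg := isRegularAt_div p q c hq
  set r := algebraMap K[X] (RatFunc K) p / algebraMap K[X] (RatFunc K) q with hr
  have h1 : p * r.denom = r.num * q := by
    have := (RatFunc.num_div_denom r).trans hr
    rw [div_eq_div_iff (by simpa using r.denom_ne_zero) (by simpa using hq0)] at this
    rw [← map_mul, ← map_mul] at this
    exact (RatFunc.algebraMap_injective K this).symm
  have h2 : (taylor c p : PowerSeries K) * (taylor c r.denom : PowerSeries K) =
      (taylor c r.num : PowerSeries K) * (taylor c q : PowerSeries K) := by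
    rw [← Polynomial.coe_mul, ← Polynomial.coe_mul, ← taylor_mul, ← taylor_mul, h1]
  unfold expansion
  rw [PowerSeries.eq_mul_inv_iff_mul_eq (by rwa [constCoeff_taylor]), mul_right_comm, ← h2,
    mul_assoc, PowerSeries.mul_inv_cancel _ (by rwa [constCoeff_taylor]), mul_one]

theorem expansion_ratDeriv (r : RatFunc K) (c : K) (h : IsRegularAt r c) :
    IsRegularAt (ratDeriv r) c ∧
      expansion (ratDeriv r) c = PowerSeries.derivative K (expansion r c) := by
  have h2 : (r.denom ^ 2).eval c ≠ 0 := by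
    rw [eval_pow]
    exact pow_ne_zero 2 h
  refine ⟨isRegularAt_div _ _ _ h2, ?_⟩
  have hd : ∀ p : K[X], taylor c (derivative p) = derivative (taylor c p) := by
    intro p
    simp [taylor_apply, derivative_comp]
  unfold ratDeriv
  rw [expansion_div _ _ _ h2]
  unfold expansion
  have hc : PowerSeries.constantCoeff (taylor c r.denom : PowerSeries K) ≠ 0 := by
    rwa [constCoeff_taylor]
  have hi := PowerSeries.mul_inv_cancel _ hc
  simp only [Derivation.leibniz, PowerSeries.derivative_inv', PowerSeries.derivative_coe,
    smul_eq_mul, map_sub, taylor_mul, Polynomial.coe_sub, Polynomial.coe_mul, hd, pow_two, PowerSeries.mul_inv_rev]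
  linear_combination ((taylor c r.denom : PowerSeries K)⁻¹ *
    (derivative (taylor c r.num) : PowerSeries K)) * hi

/-- The Taylor coefficients are the iterated derivatives divided by factorials: where `r` is
regular, `r⁽ʲ⁾(c) = j! * taylorCoeff r c j`. -/
theorem eval_iterate_ratDeriv (r : RatFunc K) (c : K) (h : IsRegularAt r c) (j : ℕ) :
    IsRegularAt (ratDeriv^[j] r) c ∧
      (ratDeriv^[j] r).eval (RingHom.id K) c = (j.factorial : K) * taylorCoeff r c j := by
  have key : ∀ j, IsRegularAt (ratDeriv^[j] r) c ∧
      expansion (ratDeriv^[j] r) c = (PowerSeries.derivative K)^[j] (expansion r c) := by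
    intro j
    induction j with
    | zero => exact ⟨h, rfl⟩
    | succ j ih =>
      rw [Function.iterate_succ_apply', Function.iterate_succ_apply', ← ih.2]
      exact expansion_ratDeriv _ _ ih.1
  refine ⟨(key j).1, ?_⟩
  have h3 : ∀ s : RatFunc K, s.eval (RingHom.id K) c =
      PowerSeries.constantCoeff (expansion s c) := by
    intro s
    simp only [expansion, map_mul, PowerSeries.constantCoeff_inv, constCoeff_taylor, RatFunc.eval]
    rw [div_eq_mul_inv]
    rfl
  rw [h3, (key j).2, PowerSeries.constantCoeff_iterate_derivative, taylorCoeff]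

/-! ### The interpolation data -/

section Data

variable {k : ℕ} (x : Fin (k + 1) → K) (m : Fin (k + 1) → ℕ) (y : (i : Fin (k + 1)) → Fin (m i) → K)

/-- The pair `(A, B)` solves the osculatory rational interpolation problem with degree bounds
`(a, b)`: the rational function `A / B` is defined at every node at which a condition is imposed,
and its `j`-th Taylor coefficient at `x i` is `y i j`, for `0 ≤ j < m i`. -/
structure IsSolution (a b : ℕ) (A B : K[X]) : Prop where
  natDegree_num : A.natDegree ≤ a
  natDegree_den : B.natDegree ≤ b
  den_ne_zero : B ≠ 0
  interp : ∀ (i : Fin (k + 1)) (j : Fin (m i)),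
    IsRegularAt (algebraMap K[X] (RatFunc K) A / algebraMap K[X] (RatFunc K) B) (x i) ∧
    taylorCoeff (algebraMap K[X] (RatFunc K) A / algebraMap K[X] (RatFunc K) B) (x i) j = y i j

/-- The polynomial `f = ∏ (X - x i) ^ (m i)`. -/
def nodePoly : K[X] := ∏ i, (X - C (x i)) ^ m i

/-- `g` has degree less than `∑ m i`, and its `j`-th Hasse derivative at `x i` is `y i j`. -/
def IsHermite (g : K[X]) : Prop :=
  g.degree < (∑ i, m i : ℕ) ∧
    ∀ (i : Fin (k + 1)) (j : Fin (m i)), (hasseDeriv (j : ℕ) g).eval (x i) = y i j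

theorem nodePoly_dvd (hx : Function.Injective x) (p : K[X])
    (hp : ∀ (i : Fin (k + 1)) (j : Fin (m i)), (hasseDeriv (j : ℕ) p).eval (x i) = 0) :
    nodePoly x m ∣ p := by
  unfold nodePoly
  apply Finset.prod_dvd_of_coprime
  · intro i _ j _ hij
    exact (pairwise_coprime_X_sub_C hx hij).pow
  · intro i _
    rw [X_sub_C_pow_dvd_iff, X_pow_dvd_iff]
    intro d hd
    rw [← taylor_apply, taylor_coeff]
    exact hp i ⟨d, hd⟩

theorem existsUnique_isHermite (hx : Function.Injective x) : ∃! g, IsHermite x m y g := by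
  have hdeg : (nodePoly x m).degree = (∑ i, m i : ℕ) := by
    simp [nodePoly, degree_prod]
  have hinj0 : ∀ p : K[X], p.degree < (∑ i, m i : ℕ) →
      (∀ (i : Fin (k + 1)) (j : Fin (m i)), (hasseDeriv (j : ℕ) p).eval (x i) = 0) → p = 0 := by
    intro p hp h
    exact eq_zero_of_dvd_of_degree_lt (nodePoly_dvd x m hx p h) (by rwa [hdeg])
  let L : degreeLT K (∑ i, m i) →ₗ[K] ((i : Fin (k + 1)) × Fin (m i)) → K :=
    LinearMap.pi fun s => (leval (x s.1)).comp ((hasseDeriv (s.2 : ℕ)).comp (Submodule.subtype _))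
  have hL : Function.Injective L := by
    rw [← LinearMap.ker_eq_bot, LinearMap.ker_eq_bot']
    rintro ⟨p, hp⟩ h
    have := hinj0 p (mem_degreeLT.1 hp) fun i j => congrFun h ⟨i, j⟩
    exact Subtype.ext this
  have hfin : Module.finrank K (degreeLT K (∑ i, m i)) =
      Module.finrank K (((i : Fin (k + 1)) × Fin (m i)) → K) := by
    rw [(degreeLTEquiv K _).finrank_eq]
    simp
  have : FiniteDimensional K (degreeLT K (∑ i, m i)) :=
    Module.Finite.equiv (degreeLTEquiv K _).symm
  obtain ⟨⟨g, hg⟩, hgy⟩ :=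
    (LinearMap.injective_iff_surjective_of_finrank_eq_finrank hfin).1 hL fun s => y s.1 s.2
  refine ⟨g, ⟨mem_degreeLT.1 hg, fun i j => congrFun hgy ⟨i, j⟩⟩, ?_⟩
  intro g' hg'
  rw [← sub_eq_zero]
  refine hinj0 _ ((degree_sub_le _ _).trans_lt (max_lt hg'.1 (mem_degreeLT.1 hg))) ?_
  intro i j
  rw [map_sub, eval_sub, hg'.2 i j, sub_eq_zero]
  exact (congrFun hgy ⟨i, j⟩).symm

/-- The Hermite interpolation polynomial of the data. -/
def hermitePoly (hx : Function.Injective x) : K[X] :=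
  (existsUnique_isHermite x m y hx).choose

theorem isHermite_hermitePoly (hx : Function.Injective x) :
    IsHermite x m y (hermitePoly x m y hx) :=
  (existsUnique_isHermite x m y hx).choose_spec.1

end Data

/-! ### Subresultants -/

section Subresultant

variable (l d : ℕ) (f g u v : K[X])

/-- The square matrix of size `2 * (l - d) + 1` attached to `f` (of formal degree `l + 1`) and `g`
(of formal degree `l`), for `d ≤ l`. Its rows are those of
`X ^ (l-d-1) * f, …, X ^ 0 * f, X ^ (l-d) * g, …, X ^ 0 * g`; all columns but the last hold the
coefficients of these polynomials in degrees `2 * l - d, …, d + 1`, and the last column holds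
`X ^ (l-d-1) * u, …, X ^ 0 * u, X ^ (l-d) * v, …, X ^ 0 * v`. -/
def sresMatrix : Matrix (Fin (2 * (l - d) + 1)) (Fin (2 * (l - d) + 1)) K[X] :=
  Matrix.of fun r c =>
    if (c : ℕ) < 2 * (l - d) then
      if (r : ℕ) < l - d then C ((X ^ (l - d - 1 - (r : ℕ)) * f).coeff (2 * l - d - (c : ℕ)))
      else C ((X ^ (2 * (l - d) - (r : ℕ)) * g).coeff (2 * l - d - (c : ℕ)))
    else
      if (r : ℕ) < l - d then X ^ (l - d - 1 - (r : ℕ)) * u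
      else X ^ (2 * (l - d) - (r : ℕ)) * v

/-- The `d`-th subresultant polynomial of `f` and `g`, in formal degrees `l + 1` and `l`. -/
def sres : K[X] := (sresMatrix l d f g f g).det

/-- The cofactor of `f` in the `d`-th subresultant. -/
def sresF : K[X] := (sresMatrix l d f g 1 0).det

/-- The cofactor of `g` in the `d`-th subresultant. -/
def sresG : K[X] := (sresMatrix l d f g 0 1).det

/-- The Bézout identity `Sres_d = F_d * f + G_d * g`. -/
theorem sres_eq : sres l d f g = sresF l d f g * f + sresG l d f g * g := by
  have hlast : ∀ u v : K[X], sresMatrix l d f g u v =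
      (sresMatrix l d f g 0 0).updateCol (Fin.last _) fun r =>
        sresMatrix l d f g u v r (Fin.last _) := by
    intro u v
    ext1 r c
    by_cases hc : c = Fin.last _
    · subst hc; simp
    · have : (c : ℕ) < 2 * (l - d) := by
        have := Fin.val_lt_last hc
        simpa using this
      simp [Matrix.updateCol_ne hc, sresMatrix, this]
  unfold sres sresF sresG
  rw [hlast f g, hlast 1 0, hlast 0 1, mul_comm _ f, mul_comm _ g, ← Matrix.det_updateCol_smul,
    ← Matrix.det_updateCol_smul, ← Matrix.det_updateCol_add]
  congr 2
  ext1 r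
  by_cases hr : (r : ℕ) < l - d <;> simp [sresMatrix, hr, mul_comm]

end Subresultant

end

end OscInterp

open Matrix

namespace OscInterp

noncomputable section

variable {K : Type*} [Field K]

/-! ### The coefficient matrix of the subresultants -/

/-! Clearing denominators turns the problem into the congruence A ≡ B g mod f (`IsWeakSolution`).
Where B does not vanish at a node it is a unit among power series there, so nothing is lost
(`IsHermite.nodePoly_dvd_iff`). Writing A = F f + B g, the degree bounds (d, ℓ - d) become 2(ℓ - d)
homogeneous linear equations in the 2(ℓ - d) + 1 coefficients of F and B. Their matrix is that of
Sres_d without its last column, and the cofactors of that column form a solution, which encodes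
(F_d, G_d). If Sres_d ≠ 0, the solutions form the line through (Sres_d, G_d)
(`IsWeakSolution.eq_C_mul_sres`); conversely, a line spanned by a pair with A ≠ 0 forces Sres_d ≠ 0
(`sres_ne_zero_of_span`).

Among weak solutions with bounds (a, b) and B ≠ 0, take one with numerator of least degree e. It
spans the weak solutions with bounds (e, ℓ - e), so Sres_e ≠ 0 and e ≤ d by maximality of d. It is
therefore a nonzero multiple of (Sres_d, G_d), which inherits its degrees (`sres_minimal`). Finally,
if p/q is a solution in lowest terms, then p G_d = Sres_d q by a degree count modulo f, so (Sres_d,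
G_d) = t (p, q), and minimality of deg Sres_d makes t constant. -/

/-- The multiplier of `f` encoded by the first `n` entries of `v`. -/
def multF (n : ℕ) (v : Fin (2 * n + 1) → K) : K[X] :=
  ∑ r : Fin (2 * n + 1), if (r : ℕ) < n then C (v r) * X ^ (n - 1 - (r : ℕ)) else 0

/-- The multiplier of `g` encoded by the last `n + 1` entries of `v`. -/
def multG (n : ℕ) (v : Fin (2 * n + 1) → K) : K[X] :=
  ∑ r : Fin (2 * n + 1), if (r : ℕ) < n then 0 else C (v r) * X ^ (2 * n - (r : ℕ))

theorem coeff_multF (n : ℕ) (v : Fin (2 * n + 1) → K) (r : Fin (2 * n + 1)) (hr : (r : ℕ) < n) :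
    (multF n v).coeff (n - 1 - r) = v r := by
  rw [multF, finsetSum_coeff, Finset.sum_eq_single r]
  · simp [hr]
  · intro s _ hs
    have : (s : ℕ) ≠ r := fun h => hs (Fin.ext h)
    split_ifs with h
    · rw [coeff_C_mul_X_pow, if_neg (by omega)]
    · simp
  · simp

theorem coeff_multG (n : ℕ) (v : Fin (2 * n + 1) → K) (r : Fin (2 * n + 1)) (hr : ¬ (r : ℕ) < n) :
    (multG n v).coeff (2 * n - r) = v r := by
  rw [multG, finsetSum_coeff, Finset.sum_eq_single r]
  · simp [hr]
  · intro s _ hs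
    have : (s : ℕ) ≠ r := fun h => hs (Fin.ext h)
    split_ifs with h
    · simp
    · rw [coeff_C_mul_X_pow, if_neg (by omega)]
  · simp

theorem degree_multF_lt (n : ℕ) (v : Fin (2 * n + 1) → K) : (multF n v).degree < n := by
  refine (degree_sum_le _ _).trans_lt ((Finset.sup_lt_iff (WithBot.bot_lt_coe n)).2 fun r _ => ?_)
  split_ifs with h
  · refine (degree_C_mul_X_pow_le _ _).trans_lt ?_
    exact WithBot.coe_lt_coe.2 (by simp only [Nat.cast_id]; omega)
  · simp

theorem natDegree_multG_le (n : ℕ) (v : Fin (2 * n + 1) → K) : (multG n v).natDegree ≤ n := by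
  refine natDegree_sum_le_of_forall_le _ _ fun r _ => ?_
  split_ifs with h
  · simp
  · refine (natDegree_C_mul_X_pow_le _ _).trans (by omega)

/-- Every pair of multipliers within the degree bounds is encoded by a vector. -/
theorem exists_mult_eq (n : ℕ) (F G : K[X]) (hF : F.degree < n) (hG : G.natDegree ≤ n) :
    ∃ v : Fin (2 * n + 1) → K, multF n v = F ∧ multG n v = G := by
  refine ⟨fun r => if (r : ℕ) < n then F.coeff (n - 1 - r) else G.coeff (2 * n - r), ?_, ?_⟩
  · ext j
    by_cases hj : j < n
    · have h := coeff_multF n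
        (fun r : Fin (2 * n + 1) => if (r : ℕ) < n then F.coeff (n - 1 - r) else G.coeff (2 * n - r))
        ⟨n - 1 - j, by omega⟩ (by simp; omega)
      have e : n - 1 - (n - 1 - j) = j := by omega
      have e2 : n - 1 - j < n := by omega
      simpa only [e, e2, if_true] using h
    · have hj' : ((n : ℕ) : WithBot ℕ) ≤ j := by exact_mod_cast not_lt.1 hj
      rw [coeff_eq_zero_of_degree_lt ((degree_multF_lt n _).trans_le hj'),
        coeff_eq_zero_of_degree_lt (hF.trans_le hj')]
  · ext j
    by_cases hj : j ≤ n
    · have h := coeff_multG n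
        (fun r : Fin (2 * n + 1) => if (r : ℕ) < n then F.coeff (n - 1 - r) else G.coeff (2 * n - r))
        ⟨2 * n - j, by omega⟩ (by simp; omega)
      have e : 2 * n - (2 * n - j) = j := by omega
      have e2 : ¬ 2 * n - j < n := by omega
      simpa only [e, e2, if_false] using h
    · rw [coeff_eq_zero_of_natDegree_lt ((natDegree_multG_le n _).trans_lt (not_le.1 hj)),
        coeff_eq_zero_of_natDegree_lt (hG.trans_lt (not_le.1 hj))]

theorem eq_zero_of_mult_eq_zero (n : ℕ) (v : Fin (2 * n + 1) → K) (hF : multF n v = 0)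
    (hG : multG n v = 0) : v = 0 := by
  ext r
  by_cases hr : (r : ℕ) < n
  · rw [← coeff_multF n v r hr, hF]; simp
  · rw [← coeff_multG n v r hr, hG]; simp

theorem multF_smul (n : ℕ) (t : K) (v : Fin (2 * n + 1) → K) :
    multF n (t • v) = C t * multF n v := by
  simp only [multF, Finset.mul_sum]
  refine Finset.sum_congr rfl fun r _ => ?_
  split_ifs <;> simp [mul_assoc]

theorem multG_smul (n : ℕ) (t : K) (v : Fin (2 * n + 1) → K) :
    multG n (t • v) = C t * multG n v := by
  simp only [multG, Finset.mul_sum]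
  refine Finset.sum_congr rfl fun r _ => ?_
  split_ifs <;> simp [mul_assoc]

theorem multF_mul_add_multG_mul (n : ℕ) (v : Fin (2 * n + 1) → K) (p q : K[X]) :
    multF n v * p + multG n v * q =
      ∑ r : Fin (2 * n + 1), C (v r) * (if (r : ℕ) < n then X ^ (n - 1 - (r : ℕ)) * p
        else X ^ (2 * n - (r : ℕ)) * q) := by
  simp only [multF, multG, Finset.sum_mul, ← Finset.sum_add_distrib]
  refine Finset.sum_congr rfl fun r _ => ?_
  split_ifs <;> ring

section CoeffMatrix

variable (l d : ℕ) (f g : K[X])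

/-- The matrix of `sresMatrix` with scalar entries and with zero last column. -/
def coeffMatrix : Matrix (Fin (2 * (l - d) + 1)) (Fin (2 * (l - d) + 1)) K :=
  Matrix.of fun r c =>
    if (c : ℕ) < 2 * (l - d) then
      (if (r : ℕ) < l - d then X ^ (l - d - 1 - (r : ℕ)) * f
        else X ^ (2 * (l - d) - (r : ℕ)) * g).coeff (2 * l - d - (c : ℕ))
    else 0

/-- The cofactors of the last column of `sresMatrix`. -/
def cofactorVec : Fin (2 * (l - d) + 1) → K := (coeffMatrix l d f g).adjugate (Fin.last _)

/-- Pairing with column `c` reads off one coefficient of F f + G g, so the columns before the last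
test the coefficients in degrees d + 1, …, 2l - d. -/
theorem sum_mul_coeffMatrix (v : Fin (2 * (l - d) + 1) → K) (c : Fin (2 * (l - d) + 1))
    (hc : (c : ℕ) < 2 * (l - d)) :
    ∑ r, v r * coeffMatrix l d f g r c =
      (multF (l - d) v * f + multG (l - d) v * g).coeff (2 * l - d - c) := by
  rw [multF_mul_add_multG_mul, finsetSum_coeff]
  refine Finset.sum_congr rfl fun r _ => ?_
  rw [coeff_C_mul]
  simp [coeffMatrix, hc]

theorem det_updateCol_coeffMatrix (w : Fin (2 * (l - d) + 1) → K) :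
    ((coeffMatrix l d f g).updateCol (Fin.last _) w).det = ∑ r, cofactorVec l d f g r * w r := by
  rw [← cramer_apply, cramer_eq_adjugate_mulVec]
  rfl

/-- Laplace expansion along the last column, the only one that depends on `u` and `v`; it identifies
F_d and G_d as the multipliers encoded by the cofactors. -/
theorem det_sresMatrix (u v : K[X]) :
    (sresMatrix l d f g u v).det =
      multF (l - d) (cofactorVec l d f g) * u + multG (l - d) (cofactorVec l d f g) * v := by
  have h : sresMatrix l d f g u v = ((C : K →+* K[X]).mapMatrix (coeffMatrix l d f g)).updateCol
      (Fin.last _) fun r => if (r : ℕ) < l - d then X ^ (l - d - 1 - (r : ℕ)) * u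
        else X ^ (2 * (l - d) - (r : ℕ)) * v := by
    ext1 r c
    by_cases hc : c = Fin.last _
    · subst hc; simp [sresMatrix]
    · have : (c : ℕ) < 2 * (l - d) := by simpa using Fin.val_lt_last hc
      simp only [updateCol_ne hc, sresMatrix, coeffMatrix, this, Matrix.of_apply, if_true,
        RingHom.mapMatrix_apply, Matrix.map_apply]
      split_ifs <;> rfl
  rw [h, ← cramer_apply, cramer_eq_adjugate_mulVec, ← RingHom.map_adjugate,
    multF_mul_add_multG_mul]
  rfl

theorem sresG_eq : sresG l d f g = multG (l - d) (cofactorVec l d f g) := by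
  simp [sresG, det_sresMatrix]

theorem sres_eq_mult : sres l d f g =
    multF (l - d) (cofactorVec l d f g) * f + multG (l - d) (cofactorVec l d f g) * g :=
  det_sresMatrix l d f g f g

/-- The sum is the determinant with the last column replaced by column `c`, which then occurs twice.
-/
theorem sum_cofactorVec_mul (c : Fin (2 * (l - d) + 1)) (hc : (c : ℕ) < 2 * (l - d)) :
    ∑ r, cofactorVec l d f g r * coeffMatrix l d f g r c = 0 := by
  rw [← det_updateCol_coeffMatrix]
  have hne : c ≠ Fin.last _ := fun h => by simp [h] at hc
  refine det_zero_of_column_eq hne fun r => ?_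
  simp [updateCol_ne hne]

end CoeffMatrix

/-! ### The linearized interpolation problem -/

/-- The congruence `A ≡ B * g` modulo `f`, with degree bounds on `A` and `B`. -/
structure IsWeakSolution (f g : K[X]) (s t : ℕ) (A B : K[X]) : Prop where
  natDegree_num : A.natDegree ≤ s
  natDegree_den : B.natDegree ≤ t
  dvd : f ∣ A - B * g

section Weak

variable {f g A B A' B' : K[X]} {l d s t s' t' : ℕ}

/-- Modulo `f`, both A B' and A' B are congruent to B B' g; their difference has degree less than
that of `f`. -/
theorem IsWeakSolution.mul_eq_mul (h : IsWeakSolution f g s t A B)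
    (h' : IsWeakSolution f g s' t' A' B') (h1 : A.natDegree + B'.natDegree < f.natDegree)
    (h2 : A'.natDegree + B.natDegree < f.natDegree) : A * B' = A' * B := by
  rw [← sub_eq_zero]
  refine eq_zero_of_dvd_of_natDegree_lt (p := f) ?_ ?_
  · have := dvd_sub (h.dvd.mul_right B') (h'.dvd.mul_right B)
    convert this using 1
    ring
  · refine (natDegree_sub_le _ _).trans_lt (max_lt ?_ ?_)
    · exact natDegree_mul_le.trans_lt h1
    · exact natDegree_mul_le.trans_lt h2

theorem IsWeakSolution.num_eq_zero (h : IsWeakSolution f g s t A B) (hs : s < f.natDegree)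
    (hB : B = 0) : A = 0 := by
  refine eq_zero_of_dvd_of_natDegree_lt (p := f) ?_ (h.natDegree_num.trans_lt hs)
  simpa [hB] using h.dvd

/-! ### Weak solutions as left kernel vectors of the coefficient matrix -/

theorem isWeakSolution_of_sum_eq_zero (hf : f.natDegree = l + 1) (hg : g.natDegree ≤ l)
    (hd : d ≤ l) (v : Fin (2 * (l - d) + 1) → K)
    (hv : ∀ c : Fin (2 * (l - d) + 1), (c : ℕ) < 2 * (l - d) →
      ∑ r, v r * coeffMatrix l d f g r c = 0) :
    IsWeakSolution f g d (l - d) (multF (l - d) v * f + multG (l - d) v * g)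
      (multG (l - d) v) := by
  refine ⟨?_, natDegree_multG_le _ _, ⟨multF (l - d) v, by ring⟩⟩
  rw [natDegree_le_iff_coeff_eq_zero]
  intro j hj
  by_cases hj2 : j ≤ 2 * l - d
  · have := hv ⟨2 * l - d - j, by omega⟩ (by simp; omega)
    rw [sum_mul_coeffMatrix _ _ _ _ _ _ (by simp; omega)] at this
    have e : 2 * l - d - (2 * l - d - j) = j := by omega
    simpa only [e] using this
  -- Above degree 2l - d there is nothing to test: deg F ≤ l - d - 1 and deg G ≤ l - d bound both
  -- products by 2l - d.
  · refine coeff_eq_zero_of_natDegree_lt ?_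
    refine (natDegree_add_le _ _).trans_lt (max_lt ?_ ?_)
    · by_cases h0 : multF (l - d) v = 0
      · simp [h0]; omega
      · have := (natDegree_lt_iff_degree_lt h0).2 (degree_multF_lt (l - d) v)
        refine natDegree_mul_le.trans_lt ?_
        omega
    · have := natDegree_multG_le (l - d) v
      refine natDegree_mul_le.trans_lt ?_
      omega

theorem IsWeakSolution.exists_vec (hf : f.natDegree = l + 1) (hg : g.natDegree ≤ l) (hd : d ≤ l)
    (h : IsWeakSolution f g d (l - d) A B) :
    ∃ v : Fin (2 * (l - d) + 1) → K,
      multF (l - d) v * f + multG (l - d) v * g = A ∧ multG (l - d) v = B ∧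
      ∀ c : Fin (2 * (l - d) + 1), (c : ℕ) < 2 * (l - d) →
        ∑ r, v r * coeffMatrix l d f g r c = 0 := by
  obtain ⟨F, hF⟩ := h.dvd
  have hf0 : f ≠ 0 := by rintro rfl; simp at hf
  have hA := h.natDegree_num
  have hB := h.natDegree_den
  -- A - B g has degree at most 2l - d, and dividing by `f` lowers the degree by l + 1.
  have hdeg : F.degree < (l - d : ℕ) := by
    by_cases hF0 : F = 0
    · simp [hF0]
    rw [← natDegree_lt_iff_degree_lt hF0]
    have h1 : (f * F).natDegree = l + 1 + F.natDegree := by rw [natDegree_mul hf0 hF0, hf]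
    have h2 : (f * F).natDegree ≤ max A.natDegree (B * g).natDegree := by
      rw [← hF]; exact natDegree_sub_le _ _
    have h3 : (B * g).natDegree ≤ B.natDegree + g.natDegree := natDegree_mul_le
    omega
  obtain ⟨v, hvF, hvG⟩ := exists_mult_eq (l - d) F B hdeg h.natDegree_den
  have hA' : multF (l - d) v * f + multG (l - d) v * g = A := by
    rw [hvF, hvG]; linear_combination -hF
  refine ⟨v, hA', hvG, fun c hc => ?_⟩
  rw [sum_mul_coeffMatrix _ _ _ _ _ _ hc, hA']
  exact coeff_eq_zero_of_natDegree_lt (by omega)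

theorem isWeakSolution_sres (hf : f.natDegree = l + 1) (hg : g.natDegree ≤ l) (hd : d ≤ l) :
    IsWeakSolution f g d (l - d) (sres l d f g) (sresG l d f g) := by
  rw [sres_eq_mult, sresG_eq]
  exact isWeakSolution_of_sum_eq_zero hf hg hd _ fun c hc => sum_cofactorVec_mul l d f g c hc

theorem vecMul_updateCol_coeffMatrix (v w : Fin (2 * (l - d) + 1) → K)
    (hv : ∀ c : Fin (2 * (l - d) + 1), (c : ℕ) < 2 * (l - d) →
      ∑ r, v r * coeffMatrix l d f g r c = 0) (hw : ∑ r, v r * w r = 0) :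
    v ᵥ* (coeffMatrix l d f g).updateCol (Fin.last _) w = 0 := by
  ext c
  by_cases hc : c = Fin.last _
  · subst hc
    simpa [vecMul, dotProduct] using hw
  · have hc' : (c : ℕ) < 2 * (l - d) := by simpa using Fin.val_lt_last hc
    simpa [vecMul, dotProduct, updateCol_ne hc] using hv c hc'

/-- If `Sres_d ≠ 0`, then the weak solutions with degree bounds `(d, l - d)` are the scalar
multiples of `(Sres_d, G_d)`. -/
theorem IsWeakSolution.eq_C_mul_sres (hf : f.natDegree = l + 1) (hg : g.natDegree ≤ l) (hd : d ≤ l)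
    (hne : sres l d f g ≠ 0) (h : IsWeakSolution f g d (l - d) A B) :
    ∃ t : K, A = C t * sres l d f g ∧ B = C t * sresG l d f g := by
  obtain ⟨v, hvA, hvB, hv⟩ := h.exists_vec hf hg hd
  have hc0 : cofactorVec l d f g ≠ 0 := by
    intro h0
    apply hne
    rw [sres_eq_mult, h0]
    simp [multF, multG]
  obtain ⟨r, hr⟩ := Function.ne_iff.1 hc0
  rw [Pi.zero_apply] at hr
  -- Completing the columns by the unit vector at `r` gives determinant equal to the `r`-th
  -- cofactor. A kernel vector with vanishing `r`-th entry is then zero, and `t` is chosen to make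
  -- that entry vanish.
  have hdet : ((coeffMatrix l d f g).updateCol (Fin.last _) (Pi.single r 1)).det ≠ 0 := by
    rw [det_updateCol_coeffMatrix]
    simpa [Pi.single_apply] using hr
  set t := v r / cofactorVec l d f g r with ht
  have hvt : v - t • cofactorVec l d f g = 0 := by
    refine eq_zero_of_vecMul_eq_zero hdet (vecMul_updateCol_coeffMatrix _ _ (fun c hc => ?_) ?_)
    · simp only [Pi.sub_apply, Pi.smul_apply, smul_eq_mul, sub_mul, Finset.sum_sub_distrib, hv c hc,
        mul_assoc, ← Finset.mul_sum, sum_cofactorVec_mul l d f g c hc]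
      simp
    · simp [Pi.single_apply, ht, div_mul_cancel₀ _ hr]
  rw [sub_eq_zero] at hvt
  refine ⟨t, ?_, ?_⟩
  · rw [← hvA, hvt, multF_smul, multG_smul, sres_eq_mult]
    ring
  · rw [← hvB, hvt, multG_smul, sresG_eq]

/-- A weak solution with `A ≠ 0` that spans the weak solutions with degree bounds `(d, l - d)`
forces `Sres_d ≠ 0`. -/
theorem sres_ne_zero_of_span (hf : f.natDegree = l + 1) (hg : g.natDegree ≤ l) (hd : d ≤ l)
    (hA : A ≠ 0) (h : IsWeakSolution f g d (l - d) A B)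
    (hspan : ∀ A' B', IsWeakSolution f g d (l - d) A' B' → ∃ t : K, A' = C t * A ∧ B' = C t * B) :
    sres l d f g ≠ 0 := by
  have hf0 : f ≠ 0 := by rintro rfl; simp at hf
  have key : ∀ v : Fin (2 * (l - d) + 1) → K,
      multF (l - d) v * f + multG (l - d) v * g = 0 → multG (l - d) v = 0 → v = 0 := by
    intro v h1 h2
    refine eq_zero_of_mult_eq_zero _ v ?_ h2
    simpa [h2, hf0] using h1
  obtain ⟨v, hvA, hvB, hv⟩ := h.exists_vec hf hg hd
  have hv0 : v ≠ 0 := by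
    rintro rfl
    apply hA
    rw [← hvA]
    simp [multF, multG]
  obtain ⟨r, hr⟩ := Function.ne_iff.1 hv0
  rw [Pi.zero_apply] at hr
  -- Otherwise some nonzero kernel vector `w` has `w r = 0`; being a multiple of `v`, where `v r ≠
  -- 0`, it would vanish.
  have hdet : ((coeffMatrix l d f g).updateCol (Fin.last _) (Pi.single r 1)).det ≠ 0 := by
    intro hdet
    obtain ⟨w, hw0, hw⟩ := exists_vecMul_eq_zero_iff.2 hdet
    have hwker : ∀ c : Fin (2 * (l - d) + 1), (c : ℕ) < 2 * (l - d) →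
        ∑ r, w r * coeffMatrix l d f g r c = 0 := by
      intro c hc
      have hne : c ≠ Fin.last _ := fun h => by simp [h] at hc
      simpa [vecMul, dotProduct, updateCol_ne hne] using congrFun hw c
    have hwr : w r = 0 := by
      simpa [vecMul, dotProduct, Pi.single_apply] using congrFun hw (Fin.last _)
    obtain ⟨t, h1, h2⟩ := hspan _ _ (isWeakSolution_of_sum_eq_zero hf hg hd w hwker)
    have hG : multG (l - d) w = multG (l - d) (t • v) := by rw [h2, multG_smul, hvB]
    have hF : multF (l - d) w = multF (l - d) (t • v) := by
      refine mul_right_cancel₀ hf0 ?_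
      rw [multF_smul]
      rw [multG_smul] at hG
      linear_combination h1 - g * hG - C t * hvA
    have hwt : w = t • v := by
      ext i
      by_cases hi : (i : ℕ) < l - d
      · rw [← coeff_multF _ w i hi, hF, coeff_multF _ _ i hi]
      · rw [← coeff_multG _ w i hi, hG, coeff_multG _ _ i hi]
    have ht : t = 0 := by
      have := congrFun hwt r
      rw [hwr] at this
      simpa [hr] using this.symm
    exact hw0 (by rw [hwt, ht, zero_smul])
  have hc0 : cofactorVec l d f g ≠ 0 := by
    intro h0
    apply hdet
    rw [det_updateCol_coeffMatrix, h0]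
    simp
  intro hS
  obtain ⟨t, h1, h2⟩ := hspan _ _ (isWeakSolution_sres hf hg hd)
  -- If Sres_d = 0, then `A ≠ 0` forces the factor `t` to vanish. Then G_d = 0, hence also F_d = 0,
  -- against the nonzero cofactor vector.
  have ht : t = 0 := by simpa [hS, hA] using h1
  refine hc0 (key _ ?_ ?_)
  · rw [← sres_eq_mult, hS]
  · rw [← sresG_eq, h2, ht]; simp

/-- There is one more unknown than equations; a zero last column makes the matrix square and
singular. -/
theorem exists_isWeakSolution_ne_zero (hf : f.natDegree = l + 1) (hg : g.natDegree ≤ l)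
    (hd : d ≤ l) : ∃ A B, IsWeakSolution f g d (l - d) A B ∧ B ≠ 0 := by
  have hdet : ((coeffMatrix l d f g).updateCol (Fin.last _) 0).det = 0 := by
    rw [det_updateCol_coeffMatrix]; simp
  obtain ⟨w, hw0, hw⟩ := exists_vecMul_eq_zero_iff.2 hdet
  have h : IsWeakSolution f g d (l - d) _ _ := isWeakSolution_of_sum_eq_zero hf hg hd w (by
    intro c hc
    have hne : c ≠ Fin.last _ := fun h => by simp [h] at hc
    simpa [vecMul, dotProduct, updateCol_ne hne] using congrFun hw c)
  refine ⟨_, _, h, fun hB => hw0 (eq_zero_of_mult_eq_zero _ w ?_ hB)⟩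
  have hf0 : f ≠ 0 := by rintro rfl; simp at hf
  have := h.num_eq_zero (by omega) hB
  simpa [hB, hf0] using this

/-! ### Least numerator degree -/

/-- If `d ≤ a` is the largest index with `Sres_d ≠ 0`, then `(Sres_d, G_d)` is a weak solution with
degree bounds `(a, b)`, and its numerator has the least degree among the nonzero ones. -/
theorem sres_minimal {a b : ℕ} (hf : f.natDegree = a + b + 1) (hg : g.natDegree ≤ a + b)
    (hd : IsGreatest {e : ℕ | e ≤ a ∧ sres (a + b) e f g ≠ 0} d) :
    IsWeakSolution f g a b (sres (a + b) d f g) (sresG (a + b) d f g) ∧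
      ∀ A B, IsWeakSolution f g a b A B → B ≠ 0 →
        A ≠ 0 ∧ (sres (a + b) d f g).natDegree ≤ A.natDegree := by
  obtain ⟨⟨hda, hne⟩, hmax⟩ := hd
  have hS := isWeakSolution_sres (d := d) hf hg (by omega)
  have hSd := hS.natDegree_num
  have hnum : ∀ A B, IsWeakSolution f g a b A B → B ≠ 0 → A ≠ 0 := by
    rintro A B h hB rfl
    have hBb := h.natDegree_den
    refine hne ?_
    -- With numerator 0, `f` divides B g and hence Sres_d B, whose degree is at most d + b ≤ a + b <
    -- deg f.
    have hfd : f ∣ sres (a + b) d f g * B := by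
      have h3 := dvd_sub (hS.dvd.mul_right B) (h.dvd.mul_right (sresG (a + b) d f g))
      convert h3 using 1
      ring
    have := eq_zero_of_dvd_of_natDegree_lt hfd (natDegree_mul_le.trans_lt (by omega))
    exact (mul_eq_zero.1 this).resolve_right hB
  obtain ⟨A1, B1, h1, hB1⟩ := exists_isWeakSolution_ne_zero (d := a) hf hg (by omega)
  rw [Nat.add_sub_cancel_left] at h1
  classical
  have hex : ∃ e, ∃ A B, IsWeakSolution f g a b A B ∧ B ≠ 0 ∧ A.natDegree = e :=
    ⟨_, A1, B1, h1, hB1, rfl⟩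
  obtain ⟨A, B, h, hB, hAe⟩ := Nat.find_spec hex
  have hmin : ∀ A' B', IsWeakSolution f g a b A' B' → B' ≠ 0 → A.natDegree ≤ A'.natDegree := by
    intro A' B' h' hB'
    rw [hAe]
    exact Nat.find_min' hex ⟨A', B', h', hB', rfl⟩
  have hA := hnum A B h hB
  have hAa := h.natDegree_num
  have hBb := h.natDegree_den
  have hspan : ∀ A' B', IsWeakSolution f g A.natDegree (a + b - A.natDegree) A' B' →
      ∃ t : K, A' = C t * A ∧ B' = C t * B := by
    intro A' B' h'
    have hA'e := h'.natDegree_num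
    have hB'e := h'.natDegree_den
    have heq : A' * B = A * B' := h'.mul_eq_mul h (by omega) (by omega)
    -- The bound a + b - deg A on B' may exceed b; proportionality and deg A' ≤ deg A give deg B' ≤
    -- deg B.
    have hB'b : B'.natDegree ≤ b := by
      by_cases hB' : B' = 0
      · simp [hB']
      have hA' : A' ≠ 0 := by
        rintro rfl
        simp [hA, hB'] at heq
      have := congrArg natDegree heq
      rw [natDegree_mul hA' hB, natDegree_mul hA hB'] at this
      omega
    -- Subtracting `t` times (A, B) cancels the coefficient of A' in degree deg A. By minimality the
    -- difference must have denominator 0, hence numerator 0.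
    set t := A'.coeff A.natDegree / A.leadingCoeff with ht
    have hl : A.leadingCoeff ≠ 0 := leadingCoeff_ne_zero.2 hA
    have h'' : IsWeakSolution f g a b (A' - C t * A) (B' - C t * B) := by
      refine ⟨(natDegree_sub_le _ _).trans (max_le (by omega) ((natDegree_C_mul_le _ _).trans hAa)),
        (natDegree_sub_le _ _).trans (max_le hB'b ((natDegree_C_mul_le _ _).trans hBb)), ?_⟩
      have := dvd_sub h'.dvd (h.dvd.mul_left (C t))
      convert this using 1
      ring
    have hB'' : B' - C t * B = 0 := by
      by_contra hB''
      have hA'' := hnum _ _ h'' hB''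
      have hle := hmin _ _ h'' hB''
      have hle2 : (A' - C t * A).natDegree ≤ A.natDegree :=
        (natDegree_sub_le _ _).trans (max_le hA'e (natDegree_C_mul_le _ _))
      refine hA'' (leadingCoeff_eq_zero.1 ?_)
      rw [leadingCoeff, le_antisymm hle2 hle, coeff_sub, coeff_C_mul, coeff_natDegree, ht,
        div_mul_cancel₀ _ hl, sub_self]
    exact ⟨t, sub_eq_zero.1 (h''.num_eq_zero (by omega) hB''), sub_eq_zero.1 hB''⟩
  have hed : A.natDegree ≤ d := hmax ⟨hAa, sres_ne_zero_of_span hf hg (by omega) hA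
    ⟨le_rfl, by omega, h.dvd⟩ hspan⟩
  obtain ⟨t, htA, htB⟩ := IsWeakSolution.eq_C_mul_sres (d := d) hf hg (by omega) hne
    (A := A) (B := B) ⟨hed, by omega, h.dvd⟩
  have ht : t ≠ 0 := by
    rintro rfl
    simp at htA
    exact hA htA
  refine ⟨⟨by omega, ?_, hS.dvd⟩, fun A' B' h' hB' => ⟨hnum _ _ h' hB', ?_⟩⟩
  · rwa [htB, natDegree_C_mul ht] at hBb
  · have := hmin _ _ h' hB'
    rwa [htA, natDegree_C_mul ht] at this

end Weak

/-! ### Solutions and weak solutions -/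

section Interpolation

variable {k : ℕ} {x : Fin (k + 1) → K} {m : Fin (k + 1) → ℕ} {y : (i : Fin (k + 1)) → Fin (m i) → K}

theorem natDegree_nodePoly : (nodePoly x m).natDegree = ∑ i, m i := by
  rw [nodePoly, natDegree_prod_of_monic _ _ fun i _ => (monic_X_sub_C _).pow _]
  simp

/-- For `q c ≠ 0`, the expansions of `p / q` and of the polynomial `g` at `c` agree in
degrees `< n` exactly if `(X - c) ^ n` divides `p - q * g`. -/
theorem pow_dvd_iff_coeff_expansion (p q g : K[X]) (c : K) (hq : q.eval c ≠ 0) (n : ℕ) :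
    (X - C c) ^ n ∣ p - q * g ↔
      ∀ j < n, taylorCoeff (algebraMap K[X] (RatFunc K) p / algebraMap K[X] (RatFunc K) q) c j =
        (hasseDeriv j g).eval c := by
  have hc : PowerSeries.constantCoeff (taylor c q : PowerSeries K) ≠ 0 := by
    rwa [constCoeff_taylor]
  have hi := PowerSeries.mul_inv_cancel _ hc
  have h1 : (X - C c) ^ n ∣ p - q * g ↔
      (PowerSeries.X : PowerSeries K) ^ n ∣ (taylor c (p - q * g) : PowerSeries K) := by
    rw [X_sub_C_pow_dvd_iff, X_pow_dvd_iff, PowerSeries.X_pow_dvd_iff]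
    simp only [Polynomial.coeff_coe, taylor_apply]
  -- p - q g = q (p/q - g), where q is a unit in the power series at `c`.
  have h2 : (taylor c (p - q * g) : PowerSeries K) = (taylor c q : PowerSeries K) *
      ((taylor c p : PowerSeries K) * (taylor c q : PowerSeries K)⁻¹ - taylor c g) := by
    rw [map_sub, taylor_mul, Polynomial.coe_sub, Polynomial.coe_mul]
    linear_combination -(taylor c p : PowerSeries K) * hi
  have hu : IsUnit (taylor c q : PowerSeries K) := by
    rw [PowerSeries.isUnit_iff_constantCoeff]
    exact hc.isUnit
  rw [h1, h2, hu.dvd_mul_left, PowerSeries.X_pow_dvd_iff]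
  simp only [taylorCoeff, expansion_div p q c hq, map_sub, sub_eq_zero, Polynomial.coeff_coe,
    taylor_coeff]

/-- The prime powers at distinct nodes are coprime, so the divisibility is tested node by node.
Nodes of multiplicity 0 contribute the factor 1 and no condition. -/
theorem IsHermite.nodePoly_dvd_iff (hx : Function.Injective x) {g : K[X]} (hg : IsHermite x m y g)
    (p q : K[X]) (hq : ∀ i, 0 < m i → q.eval (x i) ≠ 0) :
    nodePoly x m ∣ p - q * g ↔ ∀ (i : Fin (k + 1)) (j : Fin (m i)),
      taylorCoeff (algebraMap K[X] (RatFunc K) p / algebraMap K[X] (RatFunc K) q) (x i) j =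
        y i j := by
  have h1 : nodePoly x m ∣ p - q * g ↔ ∀ i, (X - C (x i)) ^ m i ∣ p - q * g := by
    refine ⟨fun h i => (Finset.dvd_prod_of_mem
      (fun i => (X - C (x i)) ^ m i) (Finset.mem_univ i)).trans h, fun h => ?_⟩
    exact Finset.prod_dvd_of_coprime
      (fun i _ j _ hij => (pairwise_coprime_X_sub_C hx hij).pow) fun i _ => h i
  rw [h1]
  refine forall_congr' fun i => ?_
  rcases Nat.eq_zero_or_pos (m i) with hi | hi
  · exact iff_of_true (by rw [hi, pow_zero]; exact one_dvd _) fun j => absurd j.pos (by omega)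
  · rw [pow_dvd_iff_coeff_expansion p q g (x i) (hq i hi)]
    exact ⟨fun h j => (h j j.2).trans (hg.2 i j),
      fun h j hj => (h ⟨j, hj⟩).trans (hg.2 i ⟨j, hj⟩).symm⟩

/-- A solution in lowest terms is a weak solution whose denominator does not vanish at the
nodes. -/
theorem IsSolution.exists_reduced (hx : Function.Injective x) {g : K[X]} (hg : IsHermite x m y g)
    {a b : ℕ} {A B : K[X]} (h : IsSolution x m y a b A B) :
    ∃ p q : K[X], IsCoprime p q ∧ q ≠ 0 ∧ (∀ i, 0 < m i → q.eval (x i) ≠ 0) ∧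
      IsWeakSolution (nodePoly x m) g a b p q ∧
      algebraMap K[X] (RatFunc K) A / algebraMap K[X] (RatFunc K) B =
        algebraMap K[X] (RatFunc K) p / algebraMap K[X] (RatFunc K) q := by
  set R := algebraMap K[X] (RatFunc K) A / algebraMap K[X] (RatFunc K) B with hR
  have hreg : ∀ i, 0 < m i → R.denom.eval (x i) ≠ 0 := fun i hi => (h.interp i ⟨0, hi⟩).1
  have hRe := RatFunc.num_div_denom R
  obtain ⟨s, hs⟩ := RatFunc.denom_div_dvd A B
  rw [← hR] at hs
  have hs0 : s ≠ 0 := by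
    rintro rfl
    exact h.den_ne_zero (by simpa using hs)
  have hA : A = R.num * s := by
    have h1 : algebraMap K[X] (RatFunc K) R.num / algebraMap K[X] (RatFunc K) R.denom =
        algebraMap K[X] (RatFunc K) A / algebraMap K[X] (RatFunc K) B := hRe
    rw [div_eq_div_iff (by simpa using R.denom_ne_zero) (by simpa using h.den_ne_zero),
      ← map_mul, ← map_mul] at h1
    have h2 := RatFunc.algebraMap_injective K h1
    refine mul_right_cancel₀ R.denom_ne_zero ?_
    rw [← h2]
    linear_combination R.num * hs
  -- Cancelling the common factor `s` of A and B cannot raise degrees, so the reduced pair keeps the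
  -- bounds.
  have hdeg : ∀ p : K[X], p.natDegree ≤ (p * s).natDegree := by
    intro p
    by_cases hp : p = 0
    · simp [hp]
    · rw [natDegree_mul hp hs0]; omega
  refine ⟨R.num, R.denom, RatFunc.isCoprime_num_denom R, R.denom_ne_zero, hreg,
    ⟨?_, ?_, ?_⟩, hRe.symm⟩
  · exact (hdeg _).trans (hA ▸ h.natDegree_num)
  · exact (hdeg _).trans (hs ▸ h.natDegree_den)
  · rw [hg.nodePoly_dvd_iff hx _ _ hreg, hRe]
    exact fun i j => (h.interp i j).2

theorem IsWeakSolution.isSolution (hx : Function.Injective x) {g : K[X]} (hg : IsHermite x m y g)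
    {a b : ℕ} {A B : K[X]} (h : IsWeakSolution (nodePoly x m) g a b A B) (hB : B ≠ 0)
    (hB' : ∀ i, 0 < m i → B.eval (x i) ≠ 0) : IsSolution x m y a b A B :=
  ⟨h.natDegree_num, h.natDegree_den, hB, fun i j =>
    ⟨isRegularAt_div _ _ _ (hB' i j.pos), (hg.nodePoly_dvd_iff hx _ _ hB').1 h.dvd i j⟩⟩

end Interpolation

end

end OscInterp

/-! ### Solvability and uniqueness -/

open OscInterp in
theorem theorem2p2 {K : Type*} [Field K] (a b k : ℕ)
    (x : Fin (k + 1) → K) (hx : Function.Injective x)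
    (m : Fin (k + 1) → ℕ) (hm : ∑ i, m i = a + b + 1)
    (y : (i : Fin (k + 1)) → Fin (m i) → K)
    (f g : K[X]) (hf : f = OscInterp.nodePoly x m) (hg : g = OscInterp.hermitePoly x m y hx)
    (d : ℕ) (hd : IsGreatest {e : ℕ | e ≤ a ∧ OscInterp.sres (a + b) e f g ≠ 0} d) :
    (OscInterp.sresG (a + b) d f g).natDegree ≤ b ∧
    ((∃ A B : K[X], OscInterp.IsSolution x m y a b A B) ↔
      ∀ i, 0 < m i → (OscInterp.sresG (a + b) d f g).eval (x i) ≠ 0) ∧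
    ((∃ A B : K[X], OscInterp.IsSolution x m y a b A B) →
      OscInterp.IsSolution x m y a b (OscInterp.sres (a + b) d f g)
        (OscInterp.sresG (a + b) d f g) ∧
      (∀ A B : K[X], OscInterp.IsSolution x m y a b A B →
        algebraMap K[X] (RatFunc K) A / algebraMap K[X] (RatFunc K) B =
          algebraMap K[X] (RatFunc K) (OscInterp.sres (a + b) d f g) /
            algebraMap K[X] (RatFunc K) (OscInterp.sresG (a + b) d f g)) ∧
      IsCoprime (OscInterp.sres (a + b) d f g) (OscInterp.sresG (a + b) d f g)) := by
  have hH := isHermite_hermitePoly x m y hx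
  rw [← hg] at hH
  have hfd : f.natDegree = a + b + 1 := by rw [hf, natDegree_nodePoly, hm]
  have hgd : g.natDegree ≤ a + b := by
    have h := hH.1
    rw [hm] at h
    refine natDegree_le_iff_coeff_eq_zero.2 fun j hj => coeff_eq_zero_of_degree_lt (h.trans_le ?_)
    exact_mod_cast Nat.succ_le_of_lt hj
  obtain ⟨hS, hmin⟩ := sres_minimal hfd hgd hd
  have hne : sres (a + b) d f g ≠ 0 := hd.1.2
  set S := sres (a + b) d f g
  set G := sresG (a + b) d f g
  have hG : G ≠ 0 := fun h => hne (hS.num_eq_zero (by omega) h)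
  have hred : ∀ A B : K[X], IsSolution x m y a b A B →
      (∀ i, 0 < m i → G.eval (x i) ≠ 0) ∧
      algebraMap K[X] (RatFunc K) A / algebraMap K[X] (RatFunc K) B =
        algebraMap K[X] (RatFunc K) S / algebraMap K[X] (RatFunc K) G ∧ IsCoprime S G := by
    intro A B h
    obtain ⟨p, q, hpq, hq, hqx, hw, hAB⟩ := h.exists_reduced hx hH
    rw [← hf] at hw
    have h1 := hw.natDegree_num
    have h2 := hw.natDegree_den
    have h3 := hS.natDegree_num
    have h4 := hS.natDegree_den
    have heq : p * G = S * q := hw.mul_eq_mul hS (by omega) (by omega)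
    obtain ⟨hp, hle⟩ := hmin p q hw hq
    obtain ⟨t, ht⟩ : p ∣ S := hpq.dvd_of_dvd_mul_right ⟨G, heq.symm⟩
    have ht0 : t ≠ 0 := by
      rintro rfl
      exact hne (by simpa using ht)
    have htG : G = q * t := by
      refine mul_left_cancel₀ hp ?_
      rw [heq, ht]
      ring
    -- deg S = deg p + deg t, while minimality gives deg S ≤ deg p.
    have htu : IsUnit t := by
      rw [isUnit_iff_degree_eq_zero, degree_eq_natDegree ht0]
      rw [ht, natDegree_mul hp ht0] at hle
      have : t.natDegree = 0 := by omega
      simp [this]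
    refine ⟨fun i hi => ?_, ?_, ?_⟩
    · rw [htG, eval_mul]
      refine mul_ne_zero (hqx i hi) ?_
      exact (htu.map (evalRingHom (x i))).ne_zero
    · rw [hAB, div_eq_div_iff (by simpa using hq) (by simpa using hG), ← map_mul, ← map_mul, heq]
    · rw [ht, htG]
      exact (isCoprime_mul_unit_right htu p q).2 hpq
  have hsol : (∀ i, 0 < m i → G.eval (x i) ≠ 0) → IsSolution x m y a b S G := fun h =>
    IsWeakSolution.isSolution hx hH (hf ▸ hS) hG h
  refine ⟨hS.natDegree_den, ⟨?_, fun h => ⟨S, G, hsol h⟩⟩, ?_⟩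
  · rintro ⟨A, B, h⟩
    exact (hred A B h).1
  · rintro ⟨A, B, h⟩
    exact ⟨hsol (hred A B h).1, fun A' B' h' => (hred A' B' h').2.1, (hred A B h).2.2⟩
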